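/- Let $d\ge 2$ be an integer, $\delta\in\mathbb C\setminus\{0\}$ and $c>0$. For integers $k\ge 2$ and $1\le\nu\le k-1$ let $S:\mathbb C^k\to\mathbb C^k$ be the shift-like automorphism of type $\nu$ \[ S(z_1,\dots,z_k)=\bigl(z_2,\dots,z_k,\ \delta(z_{k-\nu+1}^d-z_1)\bigr), \] with positive Green function \[ G^+(z)=\lim_{n\to\infty}\frac1{d^n}\log^+\|S^{\nu n}(z)\| . \] For $R>0$ let $V_R=\{z\in\mathbb C^k:\|z\|_\infty<R\}$, $V_i=\{z\in\mathbb C^k:\|z\|_\infty=|z_i|\ge R\}$ for $1\le i\le k$, $V_R^+=\bigcup_{i=k-\nu+1}^{k}V_i$ and $V_R^-=\bigcup_{i=1}^{k-\nu}V_i$. (1) For all such $k$ and $\nu$, the limit $G^+(z)$ exists and is finite for every $z\in\mathbb C^k$, and there is $R_0>0$ such that for every $R\ge R_0$ one has $G^+(z)\ge c$ for all $z\in V_R^+$, and \[ \{z\in\mathbb C^k: G^+(z)<c\}\subset V_R\cup V_R^- . \] (2) Let $k\ge 3$ and $\nu=k-1$, so that $S(z_1,\dots,z_k)=(z_2,\dots,z_k,\delta(z_2^d-z_1))$.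 For every algebraic variety $\widetilde V\subset\mathbb C^k$ (the common zero set of a family of polynomials, possibly reducible) of codimension $2$, i.e. of dimension $k-2$, there is an affine change of coordinates of $\mathbb C^k$, i.e. an invertible affine map $A:\mathbb C^k\to\mathbb C^k$, such that \[ \{z\in\mathbb C^k: G^+(z)<c\}\cap A(\widetilde V)=\emptyset . \] -/

import Mathlib

open Filter Topology

/-- The shift-like map of type `ν` (with `1 ≤ ν ≤ k - 1`) on `ℂ^k`,
`S(z₁, …, z_k) = (z₂, …, z_k, δ (z_{k-ν+1}^d - z₁))`.
Coordinates are numbered from `0`, so that `z_{k-ν+1}` is the coordinate with number `k - ν`. -/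
def shiftLike {k ν : ℕ} (hν : 0 < ν) (hνk : ν < k) (d : ℕ) (δ : ℂ) (z : Fin k → ℂ) : Fin k → ℂ :=
  fun i =>
    if h : i.val + 1 < k then z ⟨i.val + 1, h⟩
    else δ * (z ⟨k - ν, by omega⟩ ^ d - z ⟨0, by omega⟩)

/-- The `n`-th term `d⁻ⁿ log⁺ ‖S^{νn}(z)‖` of the sequence that defines the positive Green
function. The norm on `Fin k → ℂ` is the maximum norm; the limit is the same for every norm. -/
noncomputable def greenPlusSeq {k ν : ℕ} (hν : 0 < ν) (hνk : ν < k) (d : ℕ) (δ : ℂ)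
    (z : Fin k → ℂ) (n : ℕ) : ℝ :=
  (1 / (d : ℝ) ^ n) * Real.posLog ‖(shiftLike hν hνk d δ)^[ν * n] z‖

/-- The positive Green function `G⁺(z) = lim_{n → ∞} d⁻ⁿ log⁺ ‖S^{νn}(z)‖`. -/
noncomputable def greenPlus {k ν : ℕ} (hν : 0 < ν) (hνk : ν < k) (d : ℕ) (δ : ℂ)
    (z : Fin k → ℂ) : ℝ :=
  limUnder atTop (greenPlusSeq hν hνk d δ z)

/-- The open polydisc `V_R = Δ^k(0; R)`. -/
def polydisc (k : ℕ) (R : ℝ) : Set (Fin k → ℂ) := {z | ∀ i, ‖z i‖ < R}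

/-- `V_i = {z : ‖z‖_∞ = |z_i| ≥ R}`. -/
def sectorV {k : ℕ} (R : ℝ) (i : Fin k) : Set (Fin k → ℂ) := {z | ‖z‖ = ‖z i‖ ∧ R ≤ ‖z i‖}

/-- `V_R⁺`, the union of the last `ν` of the sets `V_i`. -/
def filtPlus (k ν : ℕ) (R : ℝ) : Set (Fin k → ℂ) := ⋃ i : Fin k, ⋃ _ : k - ν ≤ i.val, sectorV R i

/-- `V_R⁻`, the union of the first `k - ν` of the sets `V_i`. -/
def filtMinus (k ν : ℕ) (R : ℝ) : Set (Fin k → ℂ) := ⋃ i : Fin k, ⋃ _ : i.val < k - ν, sectorV R i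

/-- `V` is an affine algebraic subset of `ℂ^k`. -/
def IsAlgebraicVariety {k : ℕ} (V : Set (Fin k → ℂ)) : Prop :=
  ∃ I : Ideal (MvPolynomial (Fin k) ℂ), V = MvPolynomial.zeroLocus ℂ I

/-- The dimension of `V`: the Krull dimension of its coordinate ring `ℂ[z₁, …, z_k] / I(V)`
(it is `⊥` for the empty set). -/
noncomputable def varietyDim {k : ℕ} (V : Set (Fin k → ℂ)) : WithBot ℕ∞ :=
  ringKrullDim (MvPolynomial (Fin k) ℂ ⧸ MvPolynomial.vanishingIdeal ℂ V)

/-! On `V_R⁺` with `R` large, a dominant coordinate `z_i` lies among the last `ν`, and `S^ν`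
replaces it by `δ (z_i^d - z_j)`, where the linear term is negligible. So `V_R⁺` is forward
invariant, and `log ‖S^ν z‖` differs from `d log ‖z‖` by at most a constant `C`. Telescoping gives a
limit `G⁺(z) ≥ log ‖z‖ - 2C`, hence `G⁺ ≥ c` for large `R`. An orbit of `S^ν` that never enters
`V_R⁺` is bounded, so `G⁺ = 0` there.

For `ν = k - 1`, `V_R⁺` is the region where the maximum norm is at least `R` and is attained off the
first coordinate, so it suffices to move `V` into it (`exists_affineEquiv_image_subset_filtPlus`).
As `V` lies in a hypersurface, there is a direction `v` along which points of `V` grow at most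
linearly in the remaining coordinates. As `dim V < k - 1`, the projection of `V` along `v` satisfies
a polynomial relation and misses a ball. Moving the centre of that ball to the origin, dilating the
projected coordinates and contracting the direction `v` gives the required map. -/

/-! ### Krull dimension and algebraic relations on a variety -/

/-- The Krull dimension does not drop along an injective integral extension. -/
theorem ringKrullDim_le_of_isIntegral (R S : Type*) [CommRing R] [CommRing S] [Algebra R S]
    [Algebra.IsIntegral R S] (hinj : Function.Injective (algebraMap R S)) :
    ringKrullDim R ≤ ringKrullDim S := by
  refine iSup_le fun l => ?_
  obtain ⟨Q, -, hQ, hQl⟩ := Ideal.exists_ideal_over_prime_of_isIntegral (S := S)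
    (RelSeries.head l).asIdeal ⊥ (by rw [Ideal.comap_bot_of_injective _ hinj]; exact bot_le)
  have : Q.LiesOver (RelSeries.head l).asIdeal := ⟨hQl.symm⟩
  obtain ⟨L, hL, -, -⟩ := Ideal.exists_ltSeries_of_hasGoingUp l Q
  rw [← hL]
  exact le_iSup (fun L : LTSeries (PrimeSpectrum S) => ((L.length : ℕ∞) : WithBot ℕ∞)) L

/-- By Noether normalization `A` is integral over a polynomial ring in `s` variables. These form a
transcendence basis, so `n ≤ s`, while integrality gives `s ≤ dim A`. -/
theorem AlgebraicIndependent.le_ringKrullDim_of_isDomain {K A : Type*} [Field K] [CommRing A]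
    [IsDomain A] [Algebra K A] [Algebra.FiniteType K A] {n : ℕ} {x : Fin n → A}
    (hx : AlgebraicIndependent K x) : (n : WithBot ℕ∞) ≤ ringKrullDim A := by
  obtain ⟨s, g, hg, hgint⟩ := exists_integral_inj_algHom_of_fg K A
  have hdim : (s : WithBot ℕ∞) ≤ ringKrullDim A := by
    algebraize [g.toRingHom]
    simpa using ringKrullDim_le_of_isIntegral (MvPolynomial (Fin s) K) A hg
  refine le_trans ?_ hdim
  have hbasis : IsTranscendenceBasis K (fun i : Fin s => g (MvPolynomial.X i)) := by
    algebraize [g.toRingHom]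
    have : IsScalarTower K (MvPolynomial (Fin s) K) A :=
      IsScalarTower.of_algebraMap_eq fun r => (g.commutes r).symm
    have : FaithfulSMul (MvPolynomial (Fin s) K) A :=
      (faithfulSMul_iff_algebraMap_injective _ _).mpr hg
    exact (IsTranscendenceBasis.mvPolynomial (Fin s) K).algebraMap_comp
  have h1 := hx.lift_cardinalMk_le_trdeg
  have h2 := hbasis.lift_cardinalMk_eq_trdeg
  rw [← h2] at h1
  simpa using h1

/-- A finitely generated algebra over a field that contains `n` algebraically independent elements
has Krull dimension at least `n`. -/
theorem AlgebraicIndependent.le_ringKrullDim {K A : Type*} [Field K] [CommRing A]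
    [Algebra K A] [Algebra.FiniteType K A] {n : ℕ} {x : Fin n → A}
    (hx : AlgebraicIndependent K x) : (n : WithBot ℕ∞) ≤ ringKrullDim A := by
  -- A prime `p` that meets the polynomial subalgebra in zero: modulo `p` the elements stay
  -- independent, and the quotient is a domain.
  obtain ⟨p, hp, hpc⟩ := Ideal.exists_comap_eq_of_mem_minimalPrimes_of_injective
    (f := (MvPolynomial.aeval x : MvPolynomial (Fin n) K →ₐ[K] A).toRingHom) hx ⊥
    (by simp [IsDomain.minimalPrimes_eq_singleton_bot])
  have hxp : AlgebraicIndependent K (fun i => Ideal.Quotient.mkₐ K p (x i)) := by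
    rw [algebraicIndependent_iff]
    intro q hq
    have : Ideal.Quotient.mkₐ K p (MvPolynomial.aeval x q) = 0 := by
      rw [← hq, MvPolynomial.comp_aeval_apply]
    have hmem : q ∈ Ideal.comap
        (MvPolynomial.aeval x : MvPolynomial (Fin n) K →ₐ[K] A).toRingHom p :=
      Ideal.mem_comap.mpr (Ideal.Quotient.eq_zero_iff_mem.mp this)
    rwa [hpc] at hmem
  exact hxp.le_ringKrullDim_of_isDomain.trans (ringKrullDim_quotient_le p)

/-- Any `n` polynomial functions on an affine variety of dimension less than `n` satisfy a
nontrivial polynomial relation. -/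
theorem exists_relation_of_varietyDim_lt {k n : ℕ} {V : Set (Fin k → ℂ)} (hV : varietyDim V < n)
    (y : Fin n → MvPolynomial (Fin k) ℂ) :
    ∃ g : MvPolynomial (Fin n) ℂ, g ≠ 0 ∧
      ∀ z ∈ V, MvPolynomial.eval (fun i => MvPolynomial.eval z (y i)) g = 0 := by
  by_contra! hcon
  refine hV.not_ge (AlgebraicIndependent.le_ringKrullDim (K := ℂ)
    (x := fun i => Ideal.Quotient.mkₐ ℂ (MvPolynomial.vanishingIdeal ℂ V) (y i)) ?_)
  rw [algebraicIndependent_iff]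
  intro q hq
  by_contra hne
  obtain ⟨z, hz, hzq⟩ := hcon q hne
  have : Ideal.Quotient.mkₐ ℂ (MvPolynomial.vanishingIdeal ℂ V) (MvPolynomial.aeval y q) = 0 := by
    rw [← hq, MvPolynomial.comp_aeval_apply]
  have hmem := MvPolynomial.mem_vanishingIdeal_iff.mp (Ideal.Quotient.eq_zero_iff_mem.mp this) z hz
  apply hzq
  rw [← hmem, MvPolynomial.comp_aeval_apply]
  simp only [MvPolynomial.aeval_eq_eval]

/-! ### Zero sets of polynomials: asymptotic directions and missed balls -/

theorem MvPolynomial.IsHomogeneous.eval_smul' {σ R : Type*} [CommSemiring R]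
    {φ : MvPolynomial σ R} {n : ℕ} (hφ : φ.IsHomogeneous n) (c : R) (x : σ → R) :
    MvPolynomial.eval (c • x) φ = c ^ n * MvPolynomial.eval x φ := by
  rw [MvPolynomial.eval_eq, MvPolynomial.eval_eq, Finset.mul_sum]
  refine Finset.sum_congr rfl fun m hm => ?_
  have hdeg : m.degree = n := by
    rw [Finsupp.degree_eq_weight_one]
    exact hφ (MvPolynomial.mem_support_iff.mp hm)
  have : ∏ i ∈ m.support, (c • x) i ^ m i = c ^ n * ∏ i ∈ m.support, x i ^ m i := by
    simp only [Pi.smul_apply, smul_eq_mul, mul_pow, Finset.prod_mul_distrib,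
      Finset.prod_pow_eq_pow_sum]
    rw [← hdeg]; rfl
  rw [this]; ring

/-- After a choice of a direction `v` that is not asymptotic to the hypersurface `f = 0`, the
component of a zero of `f` along `v` grows at most linearly in the other components. -/
theorem exists_direction_of_ne_zero {m : ℕ} {f : MvPolynomial (Fin (m + 1)) ℂ} (hf : f ≠ 0) :
    ∃ v : Fin (m + 1) → ℂ, v 0 ≠ 0 ∧ ∃ r : ℝ, 0 < r ∧ ∀ z, MvPolynomial.eval z f = 0 →
      r * ‖z 0 / v 0‖ ≤ max 1 ‖z - (z 0 / v 0) • v‖ := by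
  set D := f.totalDegree with hD
  have htop : MvPolynomial.homogeneousComponent D f ≠ 0 := by
    obtain ⟨s, hs, hsD⟩ := Finset.exists_mem_eq_sup f.support
      (MvPolynomial.support_nonempty.mpr hf) (fun s => s.degree)
    intro h
    have h2 := MvPolynomial.coeff_homogeneousComponent (n := D) (φ := f) s
    rw [h, if_pos] at h2
    · exact MvPolynomial.mem_support_iff.mp hs h2.symm
    · rw [hD, ← hsD]; rfl
  -- The factor `X 0` secures `v 0 ≠ 0` together with the nonvanishing of the leading form at `v`.
  obtain ⟨v, hv⟩ : ∃ v, MvPolynomial.eval v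
      (MvPolynomial.homogeneousComponent D f * MvPolynomial.X 0) ≠ 0 := by
    by_contra! h
    exact mul_ne_zero htop (MvPolynomial.X_ne_zero 0) (MvPolynomial.funext (by simpa using h))
  rw [map_mul, MvPolynomial.eval_X] at hv
  have hv0 := right_ne_zero_of_mul hv
  -- `F` is the homogenization of `f`, with `F (v, 0)` the leading form at `v`. If `w` were large
  -- against `1` and `z - w • v`, then `(w⁻¹ • z, w⁻¹)` would be close to `(v, 0)`, where `F ≠ 0`,
  -- although `F` equals `w⁻¹ ^ D * f(z) = 0` there.
  let F : (Fin (m + 1) → ℂ) × ℂ → ℂ := fun q => ∑ j ∈ Finset.range (D + 1),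
    q.2 ^ (D - j) * MvPolynomial.eval q.1 (MvPolynomial.homogeneousComponent j f)
  have hFc : Continuous F := by
    refine continuous_finsetSum _ fun j _ => (by fun_prop : Continuous _).mul ?_
    exact (MvPolynomial.continuous_eval _).comp continuous_fst
  have hFv : F (v, 0) ≠ 0 := by
    have : F (v, 0) = MvPolynomial.eval v (MvPolynomial.homogeneousComponent D f) := by
      simp only [F]
      rw [Finset.sum_range_succ, Finset.sum_eq_zero]
      · simp
      · intro j hj
        rw [zero_pow (by have := Finset.mem_range.mp hj; omega), zero_mul]
    rw [this]
    exact left_ne_zero_of_mul hv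
  obtain ⟨r, hr, hball⟩ := Metric.eventually_nhds_iff.mp (hFc.continuousAt.eventually_ne hFv)
  refine ⟨v, hv0, r, hr, fun z hz => ?_⟩
  set w := z 0 / v 0
  by_contra! hlt
  have hw : 0 < ‖w‖ := by
    by_contra! h
    nlinarith [le_max_left 1 ‖z - w • v‖]
  have hw0 : w ≠ 0 := norm_pos_iff.mp hw
  have hne : F (w⁻¹ • z, w⁻¹) ≠ 0 := by
    apply hball
    rw [Prod.dist_eq, max_lt_iff]
    constructor
    · have : w⁻¹ • z - v = w⁻¹ • (z - w • v) := by rw [smul_sub, inv_smul_smul₀ hw0]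
      rw [dist_eq_norm, this, norm_smul, norm_inv, inv_mul_lt_iff₀ hw]
      linarith [le_max_right 1 ‖z - w • v‖]
    · rw [dist_zero_right, norm_inv, inv_lt_iff_one_lt_mul₀ hw]
      linarith [le_max_left 1 ‖z - w • v‖]
  apply hne
  have : F (w⁻¹ • z, w⁻¹) = (w⁻¹) ^ D * MvPolynomial.eval z f := by
    conv_rhs => rw [← MvPolynomial.sum_homogeneousComponent f, map_sum, Finset.mul_sum]
    refine Finset.sum_congr rfl fun j hj => ?_
    rw [(MvPolynomial.homogeneousComponent_isHomogeneous j f).eval_smul', ← mul_assoc, ← pow_add]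
    congr 2
    have := Finset.mem_range.mp hj
    omega
  rw [this, hz, mul_zero]

theorem exists_ball_disjoint_of_ne_zero {m : ℕ} {g : MvPolynomial (Fin m) ℂ} (hg : g ≠ 0) :
    ∃ (p : Fin m → ℂ) (r : ℝ), 0 < r ∧ ∀ x, MvPolynomial.eval x g = 0 → r ≤ ‖x - p‖ := by
  obtain ⟨p, hp⟩ : ∃ p, MvPolynomial.eval p g ≠ 0 := by
    by_contra! h
    exact hg (MvPolynomial.funext (by simpa using h))
  obtain ⟨r, hr, hball⟩ := Metric.eventually_nhds_iff.mp
    ((MvPolynomial.continuous_eval g).continuousAt.eventually_ne hp)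
  refine ⟨p, r, hr, fun x hx => ?_⟩
  by_contra! h
  exact hball (by rwa [dist_eq_norm]) hx

/-! ### Moving a variety of codimension two by an affine map -/

/-- The affine automorphism that uses `v` as the first basis vector, scales the first coordinate
by `ε`, and moves `p` to the origin of the other coordinates, which are scaled by `lam`. -/
theorem exists_affineEquiv_shear {m : ℕ} {v : Fin (m + 1) → ℂ} (hv : v 0 ≠ 0) {ε lam : ℂ}
    (hε : ε ≠ 0) (hlam : lam ≠ 0) (p : Fin m → ℂ) :
    ∃ A : (Fin (m + 1) → ℂ) ≃ᵃ[ℂ] (Fin (m + 1) → ℂ), ∀ z, A z 0 = ε * (z 0 / v 0) ∧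
      ∀ j : Fin m, A z j.succ = lam * (z j.succ - z 0 / v 0 * v j.succ - p j) := by
  let T : (Fin (m + 1) → ℂ) ≃ₗ[ℂ] (Fin (m + 1) → ℂ) :=
    { toFun := fun z => Fin.cons (ε * (z 0 / v 0))
        fun j => lam * (z j.succ - z 0 / v 0 * v j.succ)
      invFun := fun y => Fin.cons (y 0 / ε * v 0) fun j => y j.succ / lam + y 0 / ε * v j.succ
      map_add' := fun x y => by
        ext i; refine Fin.cases ?_ (fun j => ?_) i <;> simp <;> ring
      map_smul' := fun a x => by
        ext i; refine Fin.cases ?_ (fun j => ?_) i <;> simp <;> ring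
      left_inv := fun z => by
        ext i; refine Fin.cases ?_ (fun j => ?_) i <;> simp <;> field_simp
        ring
      right_inv := fun y => by
        ext i; refine Fin.cases ?_ (fun j => ?_) i <;> simp <;> field_simp
        ring }
  refine ⟨T.toAffineEquiv.trans (AffineEquiv.constVAdd ℂ _ (Fin.cons 0 fun j => -(lam * p j))),
    fun z => ⟨?_, fun j => ?_⟩⟩
  · simp [T]
  · simp [T]; ring

/-- An affine variety of codimension at least two can be moved by an affine automorphism into the
region where the maximum norm is at least `R` and is attained away from the first coordinate. -/
theorem exists_affineEquiv_image_subset_filtPlus {m : ℕ} {V : Set (Fin (m + 1) → ℂ)}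
    (hV : varietyDim V < m) {R : ℝ} (hR : 0 < R) :
    ∃ A : (Fin (m + 1) → ℂ) ≃ᵃ[ℂ] (Fin (m + 1) → ℂ), A '' V ⊆ filtPlus (m + 1) m R := by
  obtain ⟨f, hf, hfV⟩ : ∃ f : MvPolynomial (Fin (m + 1)) ℂ, f ≠ 0 ∧
      ∀ z ∈ V, MvPolynomial.eval z f = 0 := by
    obtain ⟨f, hf, hfV⟩ := exists_relation_of_varietyDim_lt
      (hV.trans_le (by exact_mod_cast m.le_succ) : varietyDim V < (m + 1 : ℕ)) MvPolynomial.X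
    exact ⟨f, hf, by simpa using hfV⟩
  obtain ⟨v, hv, r, hr, hrV⟩ := exists_direction_of_ne_zero hf
  -- These `m` polynomials are the coordinates of the projection along `v`.
  obtain ⟨g, hg, hgV⟩ := exists_relation_of_varietyDim_lt hV
    fun j => MvPolynomial.X j.succ - MvPolynomial.C (v j.succ / v 0) * MvPolynomial.X 0
  obtain ⟨p, s, hs, hsg⟩ := exists_ball_disjoint_of_ne_zero hg
  have hB : 0 < (1 + ‖p‖) / s + 1 := by positivity
  -- Since `‖x - p‖ ≥ s`, the bound on `r * ‖w‖` becomes a multiple `(1 + ‖p‖) / s + 1` of `‖x -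
  -- p‖`. This `ε` makes the first coordinate at most `R / s * ‖x - p‖`, the norm of the others.
  set ε : ℝ := R / s * r / ((1 + ‖p‖) / s + 1) with hεdef
  have hlam : 0 < R / s := by positivity
  have hε : 0 < ε := by positivity
  obtain ⟨A, hA⟩ := exists_affineEquiv_shear hv (ε := (ε : ℂ)) (lam := ((R / s : ℝ) : ℂ))
    (by exact_mod_cast hε.ne') (by exact_mod_cast hlam.ne') p
  refine ⟨A, ?_⟩
  rintro _ ⟨z, hz, rfl⟩
  obtain ⟨hA0, hAs⟩ := hA z
  set w := z 0 / v 0 with hw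
  let x : Fin m → ℂ := fun j => z j.succ - w * v j.succ
  have hx : s ≤ ‖x - p‖ := by
    apply hsg
    have hxeq : x = fun j => MvPolynomial.eval z
        (MvPolynomial.X j.succ - MvPolynomial.C (v j.succ / v 0) * MvPolynomial.X 0) := by
      ext j
      simp only [x, w, map_sub, map_mul, MvPolynomial.eval_X, MvPolynomial.eval_C]
      ring
    rw [hxeq]
    exact hgV z hz
  -- For `m = 0` the norm `‖x - p‖` would be zero, against `s > 0`.
  have hm : Nonempty (Fin m) := by
    by_contra h
    rw [not_nonempty_iff] at h
    have : ‖x - p‖ = 0 := by rw [Subsingleton.elim (x - p) 0, norm_zero]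
    linarith
  have hzx : ‖z - w • v‖ ≤ ‖x‖ := by
    refine (pi_norm_le_iff_of_nonneg (norm_nonneg _)).mpr fun i => ?_
    refine Fin.cases ?_ (fun j => ?_) i
    · simp [w, hv]
    · simpa [x] using norm_le_pi_norm x j
  have hwx : r * ‖w‖ ≤ 1 + ‖p‖ + ‖x - p‖ := by
    have h1 := hrV z (hfV z hz)
    have h2 : ‖x‖ ≤ ‖x - p‖ + ‖p‖ := by simpa using norm_add_le (x - p) p
    refine h1.trans (max_le ?_ ?_) <;> linarith [norm_nonneg p, norm_nonneg (x - p)]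
  have hbound : ‖A z 0‖ ≤ R / s * ‖x - p‖ := by
    have h1 : 1 + ‖p‖ ≤ (1 + ‖p‖) / s * ‖x - p‖ := by
      rw [div_mul_eq_mul_div, le_div_iff₀ hs]
      gcongr
    have h2 : r * ‖w‖ ≤ ((1 + ‖p‖) / s + 1) * ‖x - p‖ := by linarith
    rw [hA0, norm_mul, Complex.norm_real, Real.norm_of_nonneg hε.le]
    calc ε * ‖w‖ = R / s / ((1 + ‖p‖) / s + 1) * (r * ‖w‖) := by rw [hεdef]; ring
      _ ≤ R / s / ((1 + ‖p‖) / s + 1) * (((1 + ‖p‖) / s + 1) * ‖x - p‖) := by gcongr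
      _ = R / s * ‖x - p‖ := by field_simp
  have hsucc : ∀ j : Fin m, ‖A z j.succ‖ = R / s * ‖(x - p) j‖ := fun j => by
    rw [hAs, norm_mul, Complex.norm_real, Real.norm_of_nonneg hlam.le]; rfl
  obtain ⟨j, hj⟩ := Finite.exists_max fun j => ‖(x - p) j‖
  have hjn : ‖x - p‖ = ‖(x - p) j‖ :=
    le_antisymm ((pi_norm_le_iff_of_nonneg (norm_nonneg _)).mpr hj) (norm_le_pi_norm _ _)
  simp only [filtPlus, Set.mem_iUnion]
  refine ⟨j.succ, by simp, le_antisymm ?_ (norm_le_pi_norm _ _), ?_⟩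
  · refine (pi_norm_le_iff_of_nonneg (norm_nonneg _)).mpr fun i => ?_
    rw [hsucc, ← hjn]
    refine Fin.cases hbound (fun i => ?_) i
    rw [hsucc]
    gcongr
    exact norm_le_pi_norm _ _
  · rw [hsucc, ← hjn, div_mul_eq_mul_div, le_div_iff₀ hs]
    gcongr

/-! ### Dynamics of `S^ν` on and off `V_R⁺` -/

section Dynamics

variable {k ν : ℕ} (hν : 0 < ν) (hνk : ν < k) (d : ℕ) (δ : ℂ)

/-- During the first `ν` steps no newly created coordinate has reached position `k - ν`, so only
original coordinates enter the formula. -/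
theorem shiftLike_iterate_apply (z : Fin k → ℂ) {m : ℕ} (hm : m ≤ ν) (i : Fin k) :
    (shiftLike hν hνk d δ)^[m] z i =
      if h : i.val + m < k then z ⟨i.val + m, h⟩
      else δ * (z ⟨i.val + m - ν, by omega⟩ ^ d - z ⟨i.val + m - k, by omega⟩) := by
  induction m generalizing i with
  | zero => simp
  | succ m ih =>
    rw [Function.iterate_succ_apply', shiftLike]
    split_ifs with h1 h2 h2
    · rw [ih (by omega), dif_pos (by simp only; omega)]
      congr 2; simp only; omega
    · rw [ih (by omega), dif_neg (by simp only; omega)]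
      congr! 5 <;> simp only <;> omega
    · omega
    · rw [ih (by omega), ih (by omega), dif_pos (by simp only; omega),
        dif_pos (by simp only; omega)]
      have e1 : k - ν + m = i.val + (m + 1) - ν := by omega
      have e2 : 0 + m = i.val + (m + 1) - k := by omega
      simp only [e1, e2]

theorem shiftLike_iterate_nu_of_lt (z : Fin k → ℂ) (i : Fin k) (hi : i.val < k - ν) :
    (shiftLike hν hνk d δ)^[ν] z i = z ⟨i.val + ν, by omega⟩ := by
  rw [shiftLike_iterate_apply hν hνk d δ z le_rfl, dif_pos]

theorem shiftLike_iterate_nu_of_le (z : Fin k → ℂ) (i : Fin k) (hi : k - ν ≤ i.val) :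
    (shiftLike hν hνk d δ)^[ν] z i = δ * (z i ^ d - z ⟨i.val + ν - k, by omega⟩) := by
  rw [shiftLike_iterate_apply hν hνk d δ z le_rfl, dif_neg (by omega)]
  congr! 4
  exact Fin.ext (by simp)

theorem exists_pi_norm_eq {k : ℕ} (hk : 0 < k) (z : Fin k → ℂ) : ∃ i, ‖z‖ = ‖z i‖ := by
  have : Nonempty (Fin k) := ⟨⟨0, hk⟩⟩
  obtain ⟨i, hi⟩ := Finite.exists_max fun i => ‖z i‖
  exact ⟨i, le_antisymm ((pi_norm_le_iff_of_nonneg (norm_nonneg _)).mpr hi) (norm_le_pi_norm _ _)⟩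

theorem mem_filtPlus_iff {R : ℝ} {z : Fin k → ℂ} :
    z ∈ filtPlus k ν R ↔ ∃ i : Fin k, k - ν ≤ i.val ∧ ‖z‖ = ‖z i‖ ∧ R ≤ ‖z i‖ := by
  simp only [filtPlus, sectorV, Set.mem_iUnion, Set.mem_ofPred_eq, exists_prop]

theorem le_norm_of_mem_filtPlus {R : ℝ} {z : Fin k → ℂ} (hz : z ∈ filtPlus k ν R) : R ≤ ‖z‖ := by
  obtain ⟨i, -, h1, h2⟩ := mem_filtPlus_iff.mp hz
  rwa [h1]

/-- On `V_R⁺` with `R` large, `S^ν` preserves `V_R⁺` and acts on the norm like `M ↦ |δ| M^d`, up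
to a factor of two. -/
theorem shiftLike_iterate_nu_mem_filtPlus (hd : 2 ≤ d) (hδ : δ ≠ 0) {R : ℝ} (hR2 : 2 ≤ R)
    (hRδ : 2 / ‖δ‖ ≤ R) {z : Fin k → ℂ} (hz : z ∈ filtPlus k ν R) :
    (shiftLike hν hνk d δ)^[ν] z ∈ filtPlus k ν R ∧
    ‖δ‖ * ‖z‖ ^ d / 2 ≤ ‖(shiftLike hν hνk d δ)^[ν] z‖ ∧
    ‖(shiftLike hν hνk d δ)^[ν] z‖ ≤ 2 * (‖δ‖ * ‖z‖ ^ d) := by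
  obtain ⟨i, hi, hzi, hRi⟩ := mem_filtPlus_iff.mp hz
  have hδ0 : 0 < ‖δ‖ := norm_pos_iff.mpr hδ
  set M := ‖z‖ with hM
  rw [← hzi] at hRi
  -- `R ≥ 2` lets the linear term cost at most half of `M ^ d`; `R ≥ 2 / ‖δ‖` then prevents the norm
  -- from decreasing.
  have hpow : M * M ≤ M ^ d := by
    rw [← sq]; exact pow_le_pow_right₀ (by linarith) hd
  have hpow2 : 2 * M ≤ M ^ d := by nlinarith
  have hgrow : M ≤ ‖δ‖ * M ^ d / 2 := by
    have h1 : 2 ≤ M * ‖δ‖ := (div_le_iff₀ hδ0).mp (hRδ.trans hRi)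
    have h2 : ‖δ‖ * (M * M) ≤ ‖δ‖ * M ^ d := by gcongr
    nlinarith
  set y := (shiftLike hν hνk d δ)^[ν] z with hy
  have hsmall : ∀ j : Fin k, j.val < k - ν → ‖y j‖ ≤ M := fun j hj => by
    rw [hy, shiftLike_iterate_nu_of_lt hν hνk d δ z j hj]
    exact norm_le_pi_norm _ _
  have hupper : ∀ j, ‖y j‖ ≤ 2 * (‖δ‖ * M ^ d) := fun j => by
    rcases lt_or_ge j.val (k - ν) with hj | hj
    · linarith [hsmall j hj]
    · rw [hy, shiftLike_iterate_nu_of_le hν hνk d δ z j hj, norm_mul]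
      have h1 : ‖z j ^ d - z ⟨j.val + ν - k, by omega⟩‖ ≤ M ^ d + M := by
        refine (norm_sub_le _ _).trans (add_le_add ?_ (norm_le_pi_norm _ _))
        rw [norm_pow]
        gcongr
        exact norm_le_pi_norm _ _
      have h2 : ‖z j ^ d - z ⟨j.val + ν - k, by omega⟩‖ ≤ 2 * M ^ d := by linarith
      calc _ ≤ ‖δ‖ * (2 * M ^ d) := by gcongr
        _ = _ := by ring
  have hlower : ‖δ‖ * M ^ d / 2 ≤ ‖y i‖ := by
    rw [hy, shiftLike_iterate_nu_of_le hν hνk d δ z i hi, norm_mul]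
    have h1 : M ^ d - M ≤ ‖z i ^ d - z ⟨i.val + ν - k, by omega⟩‖ := by
      refine le_trans ?_ (norm_sub_norm_le _ _)
      rw [norm_pow, ← hzi]
      exact sub_le_sub_left (norm_le_pi_norm _ _) _
    have h2 : M ^ d / 2 ≤ ‖z i ^ d - z ⟨i.val + ν - k, by omega⟩‖ := by linarith
    calc _ = ‖δ‖ * (M ^ d / 2) := by ring
      _ ≤ _ := by gcongr
  have hnorm : ‖δ‖ * M ^ d / 2 ≤ ‖y‖ := hlower.trans (norm_le_pi_norm _ _)
  refine ⟨?_, hnorm, (pi_norm_le_iff_of_nonneg (by positivity)).mpr hupper⟩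
  rw [mem_filtPlus_iff]
  obtain ⟨j, hj⟩ := exists_pi_norm_eq (by omega) y
  rcases lt_or_ge j.val (k - ν) with hjk | hjk
  -- If an early coordinate attains the maximum, then `‖y‖ ≤ M ≤ ‖y i‖`, so the late coordinate `i`
  -- attains it as well.
  · refine ⟨i, hi, le_antisymm ?_ (norm_le_pi_norm _ _), by linarith⟩
    linarith [hsmall j hjk]
  · exact ⟨j, hjk, hj, by linarith⟩

/-- Outside `V_R⁺` the maximum is below `R` or sits at an early coordinate, which is merely a copy
of a coordinate of `z`. -/
theorem norm_shiftLike_iterate_nu_le {R : ℝ} {z : Fin k → ℂ}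
    (hz : (shiftLike hν hνk d δ)^[ν] z ∉ filtPlus k ν R) :
    ‖(shiftLike hν hνk d δ)^[ν] z‖ ≤ max ‖z‖ R := by
  obtain ⟨j, hj⟩ := exists_pi_norm_eq (by omega) ((shiftLike hν hνk d δ)^[ν] z)
  rcases lt_or_ge j.val (k - ν) with hjk | hjk
  · rw [hj, shiftLike_iterate_nu_of_lt hν hνk d δ z j hjk]
    exact (norm_le_pi_norm _ _).trans (le_max_left _ _)
  · by_contra! h
    exact hz (mem_filtPlus_iff.mpr ⟨j, hjk, hj, by linarith [le_max_right ‖z‖ R]⟩)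

/-! ### Convergence and lower bound for the Green function -/

/-- The constant that controls `|log ‖S^ν z‖ - d log ‖z‖|` on `V_R⁺`. -/
noncomputable def greenConst (δ : ℂ) : ℝ := Real.log 2 + |Real.log ‖δ‖|

theorem greenConst_nonneg : 0 ≤ greenConst δ :=
  add_nonneg (Real.log_nonneg (by norm_num)) (abs_nonneg _)

theorem abs_posLog_shiftLike_sub_le (hd : 2 ≤ d) (hδ : δ ≠ 0) {R : ℝ} (hR2 : 2 ≤ R)
    (hRδ : 2 / ‖δ‖ ≤ R) {z : Fin k → ℂ} (hz : z ∈ filtPlus k ν R) :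
    |Real.posLog ‖(shiftLike hν hνk d δ)^[ν] z‖ - d * Real.posLog ‖z‖| ≤ greenConst δ := by
  obtain ⟨hmem, hlo, hup⟩ := shiftLike_iterate_nu_mem_filtPlus hν hνk d δ hd hδ hR2 hRδ hz
  have h1 := le_norm_of_mem_filtPlus hz
  have h2 := le_norm_of_mem_filtPlus hmem
  have hδ0 : 0 < ‖δ‖ := norm_pos_iff.mpr hδ
  have hz0 : 0 < ‖z‖ := by linarith
  rw [Real.posLog_eq_log (by rw [abs_norm]; linarith),
    Real.posLog_eq_log (by rw [abs_norm]; linarith)]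
  have e1 : Real.log (‖δ‖ * ‖z‖ ^ d) = Real.log ‖δ‖ + d * Real.log ‖z‖ := by
    rw [Real.log_mul hδ0.ne' (by positivity), Real.log_pow]
  have e2 := Real.log_le_log (by positivity) hlo
  have e3 := Real.log_le_log (by linarith) hup
  rw [Real.log_div (by positivity) (by norm_num), e1] at e2
  rw [Real.log_mul (by norm_num) (by positivity), e1] at e3
  rw [abs_le, greenConst]
  constructor <;> linarith [neg_abs_le (Real.log ‖δ‖), le_abs_self (Real.log ‖δ‖)]

theorem greenPlusSeq_add (z : Fin k → ℂ) (m n : ℕ) :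
    greenPlusSeq hν hνk d δ z (n + m) =
      1 / (d : ℝ) ^ m * greenPlusSeq hν hνk d δ ((shiftLike hν hνk d δ)^[ν * m] z) n := by
  rw [greenPlusSeq, greenPlusSeq, mul_add, Function.iterate_add_apply, pow_add]
  ring

theorem exists_tendsto_greenPlusSeq_of_mem_filtPlus (hd : 2 ≤ d) (hδ : δ ≠ 0) {R : ℝ}
    (hR2 : 2 ≤ R) (hRδ : 2 / ‖δ‖ ≤ R) {z : Fin k → ℂ} (hz : z ∈ filtPlus k ν R) :
    ∃ G, Tendsto (greenPlusSeq hν hνk d δ z) atTop (𝓝 G) ∧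
      Real.log ‖z‖ - 2 * greenConst δ ≤ G := by
  have hd2 : (2 : ℝ) ≤ d := by exact_mod_cast hd
  have hmem : ∀ n, (shiftLike hν hνk d δ)^[ν * n] z ∈ filtPlus k ν R := fun n => by
    induction n with
    | zero => simpa
    | succ n ih =>
      rw [mul_add, mul_one, add_comm, Function.iterate_add_apply]
      exact (shiftLike_iterate_nu_mem_filtPlus hν hνk d δ hd hδ hR2 hRδ ih).1
  have hstep : ∀ n, dist (greenPlusSeq hν hνk d δ z n) (greenPlusSeq hν hνk d δ z (n + 1)) ≤
      greenConst δ * (1 / (d : ℝ)) ^ n := fun n => by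
    have h := abs_posLog_shiftLike_sub_le hν hνk d δ hd hδ hR2 hRδ (hmem n)
    have hd0 : (0 : ℝ) < (d : ℝ) ^ (n + 1) := by positivity
    have e : greenPlusSeq hν hνk d δ z (n + 1) - greenPlusSeq hν hνk d δ z n =
        (Real.posLog ‖(shiftLike hν hνk d δ)^[ν] ((shiftLike hν hνk d δ)^[ν * n] z)‖ -
          d * Real.posLog ‖(shiftLike hν hνk d δ)^[ν * n] z‖) / (d : ℝ) ^ (n + 1) := by
      rw [greenPlusSeq, greenPlusSeq, mul_add, mul_one, add_comm (ν * n),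
        Function.iterate_add_apply]
      field_simp
      ring
    rw [dist_comm, Real.dist_eq, e, abs_div, abs_of_pos hd0, one_div_pow, mul_one_div]
    refine div_le_div₀ (greenConst_nonneg δ) h (by positivity) ?_
    exact pow_le_pow_right₀ (by linarith) n.le_succ
  have hr : 1 / (d : ℝ) ≤ 1 / 2 := one_div_le_one_div_of_le (by norm_num) hd2
  have hr1 : 1 / (d : ℝ) < 1 := by linarith
  obtain ⟨G, hG⟩ := cauchySeq_tendsto_of_complete (cauchySeq_of_le_geometric _ _ hr1 hstep)
  refine ⟨G, hG, ?_⟩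
  have h := dist_le_of_le_geometric_of_tendsto₀ _ _ hr1 hstep hG
  have h0 : greenPlusSeq hν hνk d δ z 0 = Real.log ‖z‖ := by
    have := le_norm_of_mem_filtPlus hz
    simp only [greenPlusSeq, mul_zero, pow_zero, div_one, one_mul, Function.iterate_zero, id]
    exact Real.posLog_eq_log (by rw [abs_norm]; linarith)
  -- The geometric series of the increments sums to at most twice the constant because `d ≥ 2`.
  have h2 : greenConst δ / (1 - 1 / (d : ℝ)) ≤ 2 * greenConst δ := by
    rw [div_le_iff₀ (by linarith)]
    nlinarith [greenConst_nonneg δ]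
  rw [h0, Real.dist_eq] at h
  linarith [le_abs_self (Real.log ‖z‖ - G)]

theorem tendsto_greenPlusSeq_zero_of_forall_notMem (hd : 2 ≤ d) {R : ℝ} {z : Fin k → ℂ}
    (hz : ∀ n, (shiftLike hν hνk d δ)^[ν * n] z ∉ filtPlus k ν R) :
    Tendsto (greenPlusSeq hν hνk d δ z) atTop (𝓝 0) := by
  have hd2 : (2 : ℝ) ≤ d := by exact_mod_cast hd
  have hbd : ∀ n, ‖(shiftLike hν hνk d δ)^[ν * n] z‖ ≤ max ‖z‖ R := fun n => by
    induction n with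
    | zero => simp
    | succ n ih =>
      have h := hz (n + 1)
      rw [mul_add, mul_one, add_comm, Function.iterate_add_apply] at h ⊢
      exact (norm_shiftLike_iterate_nu_le hν hνk d δ h).trans (max_le ih (le_max_right _ _))
  have hlim : Tendsto (fun n : ℕ => (1 / (d : ℝ)) ^ n * Real.posLog (max ‖z‖ R)) atTop (𝓝 0) := by
    rw [← zero_mul (Real.posLog (max ‖z‖ R))]
    refine (tendsto_pow_atTop_nhds_zero_of_lt_one (by positivity) ?_).mul_const _
    exact (one_div_le_one_div_of_le (by norm_num) hd2).trans_lt (by norm_num)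
  refine squeeze_zero (fun n => ?_) (fun n => ?_) hlim
  · exact mul_nonneg (by positivity) Real.posLog_nonneg
  · rw [greenPlusSeq, one_div_pow]
    gcongr
    exact hbd n

theorem tendsto_greenPlusSeq (hd : 2 ≤ d) (hδ : δ ≠ 0) (z : Fin k → ℂ) :
    Tendsto (greenPlusSeq hν hνk d δ z) atTop (𝓝 (greenPlus hν hνk d δ z)) := by
  refine tendsto_nhds_limUnder ?_
  -- Either the orbit enters the escape region and converges from then on, or it stays bounded and
  -- the limit is zero.
  by_cases h : ∃ m, (shiftLike hν hνk d δ)^[ν * m] z ∈ filtPlus k ν (max 2 (2 / ‖δ‖))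
  · obtain ⟨m, hm⟩ := h
    obtain ⟨G, hG, -⟩ := exists_tendsto_greenPlusSeq_of_mem_filtPlus hν hνk d δ hd hδ
      (le_max_left _ _) (le_max_right _ _) hm
    refine ⟨1 / (d : ℝ) ^ m * G, (tendsto_add_atTop_iff_nat m).mp ?_⟩
    simp_rw [greenPlusSeq_add]
    exact hG.const_mul _
  · push Not at h
    exact ⟨0, tendsto_greenPlusSeq_zero_of_forall_notMem hν hνk d δ hd h⟩

/-- The Green function is at least `c` on `V_R⁺` once `R` is large. -/
theorem exists_forall_le_greenPlus (hd : 2 ≤ d) (hδ : δ ≠ 0) (c : ℝ) :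
    ∃ R₀ : ℝ, 0 < R₀ ∧ ∀ R : ℝ, R₀ ≤ R → ∀ z ∈ filtPlus k ν R, c ≤ greenPlus hν hνk d δ z := by
  -- The exponential is the norm at which `log ‖z‖ - 2 * greenConst δ` reaches `c`.
  refine ⟨max (max 2 (2 / ‖δ‖)) (Real.exp (c + 2 * greenConst δ)),
    lt_max_of_lt_right (Real.exp_pos _), fun R hR z hz => ?_⟩
  obtain ⟨hR1, hR2⟩ := max_le_iff.mp hR
  obtain ⟨hR3, hR4⟩ := max_le_iff.mp hR1
  obtain ⟨G, hG, hGz⟩ :=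
    exists_tendsto_greenPlusSeq_of_mem_filtPlus hν hνk d δ hd hδ hR3 hR4 hz
  rw [tendsto_nhds_unique (tendsto_greenPlusSeq hν hνk d δ hd hδ z) hG]
  have hlog := (Real.le_log_iff_exp_le (by linarith [le_norm_of_mem_filtPlus hz])).mpr
    (hR2.trans (le_norm_of_mem_filtPlus hz))
  linarith

end Dynamics

/-! ### The sublevel set of the Green function and varieties that avoid it -/

theorem mem_polydisc_union_filtMinus_of_notMem_filtPlus {k ν : ℕ} (hνk : ν < k) {R : ℝ}
    {z : Fin k → ℂ} (hz : z ∉ filtPlus k ν R) : z ∈ polydisc k R ∪ filtMinus k ν R := by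
  obtain ⟨j, hj⟩ := exists_pi_norm_eq (by omega) z
  rcases lt_or_ge ‖z j‖ R with hlt | hge
  · exact Or.inl fun i => (norm_le_pi_norm z i).trans_lt (hj ▸ hlt)
  · right
    simp only [filtMinus, Set.mem_iUnion]
    refine ⟨j, ?_, hj, hge⟩
    by_contra! h
    exact hz (mem_filtPlus_iff.mpr ⟨j, h, hj, hge⟩)

theorem theorem4p4 (d : ℕ) (hd : 2 ≤ d) (δ : ℂ) (hδ : δ ≠ 0) (c : ℝ) (hc : 0 < c) :
    (∀ (k ν : ℕ) (hν : 0 < ν) (hνk : ν < k),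
      (∀ z : Fin k → ℂ,
        Tendsto (greenPlusSeq hν hνk d δ z) atTop (𝓝 (greenPlus hν hνk d δ z))) ∧
      ∃ R₀ : ℝ, 0 < R₀ ∧ ∀ R : ℝ, R₀ ≤ R →
        (∀ z ∈ filtPlus k ν R, c ≤ greenPlus hν hνk d δ z) ∧
        {z : Fin k → ℂ | greenPlus hν hνk d δ z < c} ⊆ polydisc k R ∪ filtMinus k ν R) ∧
    (∀ (k : ℕ) (hk : 3 ≤ k) (V : Set (Fin k → ℂ)),
      IsAlgebraicVariety V → varietyDim V + 2 = (k : WithBot ℕ∞) →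
      ∃ A : (Fin k → ℂ) ≃ᵃ[ℂ] (Fin k → ℂ),
        Disjoint
          {z : Fin k → ℂ |
            greenPlus (k := k) (ν := k - 1) (by omega) (by omega) d δ z < c}
          (A '' V)) := by
  refine ⟨fun k ν hν hνk => ⟨tendsto_greenPlusSeq hν hνk d δ hd hδ, ?_⟩, fun k hk V _ hV => ?_⟩
  · obtain ⟨R₀, hR₀, h⟩ := exists_forall_le_greenPlus hν hνk d δ hd hδ c
    refine ⟨R₀, hR₀, fun R hR => ⟨h R hR, fun z hz => ?_⟩⟩
    exact mem_polydisc_union_filtMinus_of_notMem_filtPlus hνk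
      fun hmem => (h R hR z hmem).not_gt hz
  · obtain ⟨m, rfl⟩ : ∃ m, k = m + 1 := ⟨k - 1, by omega⟩
    obtain ⟨R₀, hR₀, h⟩ := exists_forall_le_greenPlus (k := m + 1) (ν := m + 1 - 1)
      (by omega) (by omega) d δ hd hδ c
    -- Cancellation in `WithBot ℕ∞` goes by cases: for `⊥` the bound is immediate, and `⊤ + 2` is
    -- not a natural number.
    have hdim : varietyDim V < m := by
      generalize varietyDim V = D at hV
      cases D with
      | bot => exact WithBot.bot_lt_coe _
      | coe D =>
        cases D with
        | top =>
          have h1 : ((⊤ : ℕ∞) + 2) = ((m + 1 : ℕ) : ℕ∞) := WithBot.coe_injective hV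
          exact absurd (by simpa using h1.symm) (ENat.natCast_ne_top (m + 1))
        | coe D =>
          have h0 : ((D : ℕ∞) + 2) = ((m + 1 : ℕ) : ℕ∞) := WithBot.coe_injective hV
          have h1 : D + 2 = m + 1 := by exact_mod_cast h0
          exact_mod_cast (by omega : D < m)
    obtain ⟨A, hA⟩ := exists_affineEquiv_image_subset_filtPlus hdim hR₀
    refine ⟨A, Set.disjoint_left.mpr fun z hz hzA => ?_⟩
    exact (h R₀ le_rfl z (hA hzA)).not_gt hz
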